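/- Let $n\ge 1$ and let $S^{n-1}$ be the unit sphere of $\mathbb{R}^n$, with spherical Lebesgue measure $du=d\mathcal{H}^{n-1}(u)$. For a convex body $K\subset\mathbb{R}^n$ containing the origin in its interior let $h_K(u)=\sup_{x\in K}\langle u,x\rangle$ and $\rho_K(u)=\sup\{\lambda>0:\lambda u\in K\}$, $u\in S^{n-1}$, be its support and radial functions. For almost all $u\in S^{n-1}$, let $\alpha_K(u)$ be the unique outer unit normal vector of $K$ at $\rho_K(u)u\in\partial K$. For $E\subset S^{n-1}$ let $\boldsymbol{\alpha}^*_K(E)=\{x/|x|: x\in\partial K,\ \langle x,v\rangle=h_K(v)\text{ for some }v\in E\}$. For $G:(0,\infty)\times S^{n-1}\to\mathbb{R}$ with partial derivative $G_t(t,u)=\partial G(t,u)/\partial t$, and $\psi:(0,\infty)\to\mathbb{R}\setminus\{0\}$ continuous, the general dual volume and the general dual Orlicz curvature measure of $K$ are $$\widetilde V_G(K)=\int_{S^{n-1}}G(\rho_K(u),u)\,du,\qquad \widetilde C_{G,\psi}(K,E)=\frac1n\int_{\boldsymbol{\alpha}^*_K(E)}\frac{\rho_K(u)\,G_t(\rho_K(u),u)}{\psi(h_K(\alpha_K(u)))}\,du\quad(E\subset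 S^{n-1}\text{ Borel}).$$ For $a\in\mathbb{R}\cup\{-\infty\}$ let $\mathcal{J}_a$ be the class of continuous, strictly monotonic functions $\varphi:(0,\infty)\to(a,\infty)$ with $\inf_{t>0}\varphi(t)=a$ and $\sup_{t>0}\varphi(t)=\infty$. For a closed set $\Omega\subset S^{n-1}$ not contained in any closed hemisphere of $S^{n-1}$ and a continuous $f:\Omega\to(0,\infty)$ let $[f]=\bigcap_{u\in\Omega}\{x\in\mathbb{R}^n:\langle x,u\rangle\le f(u)\}$ be its Aleksandrov body. **Theorem.** Let $\Omega\subset S^{n-1}$ be a closed set not contained in any closed hemisphere, let $g:\Omega\to\mathbb{R}$ and $h_0:\Omega\to(0,\infty)$ be continuous, and let $a\in\mathbb{R}\cup\{-\infty\}$. Suppose that $\varphi\in\mathcal{J}_a$ is continuously differentiable with $\varphi'\ne0$ on $(0,\infty)$, and put $\psi(t)=t\varphi'(t)$. For $\varepsilon$ close to $0$ let $h_\varepsilon(u)=\varphi^{-1}\big(\varphi(h_0(u))+\varepsilon g(u)\big)$, $u\in\Omega$. If $G:(0,\infty)\times S^{n-1}\to\mathbb{R}$ is continuous and $G_t$ exists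 and is continuous on $(0,\infty)\times S^{n-1}$, then, for all $\varepsilon$ close to $0$, $h_\varepsilon$ is well defined on $\Omega$ and $u\mapsto G(\rho_{[h_\varepsilon]}(u),u)$ is integrable on $S^{n-1}$; the integrand defining $\widetilde C_{G,\psi}([h_0],\cdot)$ is integrable on $S^{n-1}$, the sets $\boldsymbol{\alpha}^*_{[h_0]}(E)$ with $E\subset S^{n-1}$ Borel are measurable with respect to (the completion of) $du$, and $\widetilde C_{G,\psi}([h_0],\cdot)$ is a finite signed Borel measure on $S^{n-1}$ with respect to which $g$ is integrable on $\Omega$; and $$\lim_{\varepsilon\to0}\frac{\widetilde V_G([h_\varepsilon])-\widetilde V_G([h_0])}{\varepsilon}=n\int_\Omega g(u)\,d\widetilde C_{G,\psi}([h_0],u).$$ -/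

import Mathlib

open MeasureTheory Set Filter Topology

noncomputable section

namespace DualOrlicz

/-- The unit sphere `S^{n-1}` of `ℝⁿ`, as a type. -/
abbrev Sphere (n : ℕ) : Type := Metric.sphere (0 : EuclideanSpace ℝ (Fin n)) 1

/-- The spherical Lebesgue measure `du = dℋ^{n-1}(u)` on `S^{n-1}`, normalized so that the total
mass is `n` times the volume of the unit ball. -/
def sphereMeasure (n : ℕ) : Measure (Sphere n) :=
  (volume : Measure (EuclideanSpace ℝ (Fin n))).toSphere

/-- The closed hemisphere of `S^{n-1}` centred at `v`. -/
def closedHemisphere {n : ℕ} (v : Sphere n) : Set (Sphere n) :=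
  {u | 0 ≤ inner ℝ (u : EuclideanSpace ℝ (Fin n)) v}

/-- The class `𝒥_a`, `a ∈ ℝ ∪ {-∞}`, of continuous strictly monotonic functions on `(0, ∞)` with
infimum `a` and supremum `∞` (both computed in the extended reals). As `φ` is strictly monotonic,
the infimum is not attained, so that `φ` takes its values in `(a, ∞)`. Only the restriction of
`φ` to `(0, ∞)` matters. -/
structure ClassJ (a : EReal) (φ : ℝ → ℝ) : Prop where
  ne_top : a ≠ ⊤
  continuousOn : ContinuousOn φ (Ioi 0)
  strictMono_or_strictAnti : StrictMonoOn φ (Ioi 0) ∨ StrictAntiOn φ (Ioi 0)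
  iInf_eq : ⨅ t : Ioi (0 : ℝ), ((φ t : ℝ) : EReal) = a
  iSup_eq : ⨆ t : Ioi (0 : ℝ), ((φ t : ℝ) : EReal) = ⊤

/-- `f_ε(u) = φ⁻¹(φ(f₀(u)) + ε g(u))`, where `φ⁻¹` is the inverse of `φ` on `(0, ∞)`. -/
def orliczPerturbation {n : ℕ} (φ : ℝ → ℝ) (f₀ g : Sphere n → ℝ) (ε : ℝ) (u : Sphere n) : ℝ :=
  Function.invFunOn φ (Ioi 0) (φ (f₀ u) + ε * g u)

/-- The Aleksandrov body (Wulff shape) `[f] = ⋂_{u ∈ Ω} {x | ⟨x, u⟩ ≤ f(u)}`. -/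
def aleksandrovBody {n : ℕ} (Ω : Set (Sphere n)) (f : Sphere n → ℝ) :
    Set (EuclideanSpace ℝ (Fin n)) :=
  ⋂ u ∈ Ω, {x | inner ℝ x (u : EuclideanSpace ℝ (Fin n)) ≤ f u}

/-- The support function `h_K(u) = sup_{x ∈ K} ⟨u, x⟩`. -/
def supportFn {n : ℕ} (K : Set (EuclideanSpace ℝ (Fin n))) (u : Sphere n) : ℝ :=
  sSup ((fun x => inner ℝ (u : EuclideanSpace ℝ (Fin n)) x) '' K)

/-- The radial function `ρ_K(u) = sup {λ > 0 | λ u ∈ K}`. -/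
def radialFn {n : ℕ} (K : Set (EuclideanSpace ℝ (Fin n))) (u : Sphere n) : ℝ :=
  sSup {r : ℝ | 0 < r ∧ r • (u : EuclideanSpace ℝ (Fin n)) ∈ K}

/-- The supporting hyperplane `H(K, u) = {x | ⟨x, u⟩ = h_K(u)}`. -/
def supportHyperplane {n : ℕ} (K : Set (EuclideanSpace ℝ (Fin n))) (u : Sphere n) :
    Set (EuclideanSpace ℝ (Fin n)) :=
  {x | inner ℝ x (u : EuclideanSpace ℝ (Fin n)) = supportFn K u}

/-- The spherical image `𝛎_K(B)` of a set `B` of boundary points. -/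
def sphericalImage {n : ℕ} (K B : Set (EuclideanSpace ℝ (Fin n))) : Set (Sphere n) :=
  {v | ∃ x ∈ B, x ∈ supportHyperplane K v}

/-- The reverse spherical image `𝐱_K(E)` of a set `E` of directions. -/
def reverseSphericalImage {n : ℕ} (K : Set (EuclideanSpace ℝ (Fin n))) (E : Set (Sphere n)) :
    Set (EuclideanSpace ℝ (Fin n)) :=
  {x | x ∈ frontier K ∧ ∃ v ∈ E, x ∈ supportHyperplane K v}

/-- The radial Gauss image `𝛂_K(E) = 𝛎_K({ρ_K(u) u ∈ ∂K | u ∈ E})`. -/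
def radialGaussImage {n : ℕ} (K : Set (EuclideanSpace ℝ (Fin n))) (E : Set (Sphere n)) :
    Set (Sphere n) :=
  sphericalImage K
    {x | x ∈ frontier K ∧ ∃ u ∈ E, x = radialFn K u • (u : EuclideanSpace ℝ (Fin n))}

/-- The reverse radial Gauss image `𝛂*_K(E) = {x / |x| | x ∈ 𝐱_K(E)}`. -/
def reverseRadialGaussImage {n : ℕ} (K : Set (EuclideanSpace ℝ (Fin n))) (E : Set (Sphere n)) :
    Set (Sphere n) :=
  {u | ∃ x ∈ reverseSphericalImage K E, (u : EuclideanSpace ℝ (Fin n)) = ‖x‖⁻¹ • x}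

open Classical in
/-- The radial Gauss map `α_K`: `α_K(u)` is the element of `𝛂_K({u})`. For a convex body containing
the origin in its interior that set is a singleton for almost all `u`; on the exceptional null set
some element is chosen. -/
def radialGaussMap {n : ℕ} (K : Set (EuclideanSpace ℝ (Fin n))) (u : Sphere n) : Sphere n :=
  if h : (radialGaussImage K {u}).Nonempty then h.choose else u

/-- The general dual volume `Ṽ_G(K) = ∫_{S^{n-1}} G(ρ_K(u), u) du`. -/
def generalDualVolume {n : ℕ} (G : ℝ → Sphere n → ℝ) (K : Set (EuclideanSpace ℝ (Fin n))) : ℝ :=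
  ∫ u, G (radialFn K u) u ∂(sphereMeasure n)

/-- The partial derivative `G_t(t, u) = ∂G(t, u)/∂t`. -/
def partialT {n : ℕ} (G : ℝ → Sphere n → ℝ) (t : ℝ) (u : Sphere n) : ℝ :=
  deriv (fun s => G s u) t

/-- The integrand `ρ_K(u) G_t(ρ_K(u), u) / ψ(h_K(α_K(u)))` of the general dual Orlicz curvature
measure. -/
def curvatureIntegrand {n : ℕ} (G : ℝ → Sphere n → ℝ) (ψ : ℝ → ℝ)
    (K : Set (EuclideanSpace ℝ (Fin n))) (u : Sphere n) : ℝ :=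
  radialFn K u * partialT G (radialFn K u) u / ψ (supportFn K (radialGaussMap K u))

/-- `μ` is the general dual Orlicz curvature measure of `K`, that is,
`μ(E) = (1/n) ∫_{𝛂*_K(E)} ρ_K(u) G_t(ρ_K(u), u) / ψ(h_K(α_K(u))) du` for every Borel set
`E ⊆ S^{n-1}`, where the integrals make sense. There is at most one such signed measure. -/
structure IsDualOrliczCurvatureMeasure {n : ℕ} (G : ℝ → Sphere n → ℝ) (ψ : ℝ → ℝ)
    (K : Set (EuclideanSpace ℝ (Fin n))) (μ : SignedMeasure (Sphere n)) : Prop where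
  integrable : Integrable (curvatureIntegrand G ψ K) (sphereMeasure n)
  nullMeasurableSet : ∀ E : Set (Sphere n), MeasurableSet E →
    NullMeasurableSet (reverseRadialGaussImage K E) (sphereMeasure n)
  apply_eq : ∀ E : Set (Sphere n), MeasurableSet E →
    μ E = (1 / (n : ℝ)) *
      ∫ u in reverseRadialGaussImage K E, curvatureIntegrand G ψ K u ∂(sphereMeasure n)

open Classical in
/-- The general dual Orlicz curvature measure `C̃_{G,ψ}(K, ·)`, a finite signed Borel measure on
`S^{n-1}` (with the value `0` where its defining formula does not give a signed measure). -/
def dualOrliczCurvatureMeasure {n : ℕ} (G : ℝ → Sphere n → ℝ) (ψ : ℝ → ℝ)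
    (K : Set (EuclideanSpace ℝ (Fin n))) : SignedMeasure (Sphere n) :=
  if h : ∃ μ, IsDualOrliczCurvatureMeasure G ψ K μ then h.choose else 0

end DualOrlicz

end

noncomputable section

namespace DualOrlicz

variable {n : ℕ}

/-! The gauge of `[f]` is `M_f(x) = max_{v ∈ Ω} ⟨x, v⟩ / f(v)`, and the radial function of `[f]` is
`1 / M_f` on the sphere. The variation of `ρ_{[h_ε]}(u)` is thus that of a maximum over a fixed
compact set, and an envelope theorem applies wherever the maximiser for `ε = 0` is unique.

Uniqueness holds for almost every `u`. The gauge `M` of `K = [h₀]` is Lipschitz, hence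
differentiable almost everywhere by Rademacher, and by homogeneity at almost every direction
(`ae_differentiableAt`). At such a `u` every outer normal `v` of `K` at `ρ_K(u) u` satisfies `v =
h_K(v) ∇M(u)`, so `v` is the normalised gradient (`coe_eq_of_mem_radialGaussImage`). Maximisers in
`Ω` are outer normals, so the only one is `α_K(u)`; moreover `h_K = h₀` there.

Since `1 / h_ε` has a first-order expansion uniform on `Ω` (`eventually_inv_expansion`), the
derivative of `ρ_{[h_ε]}(u)` at `0` is `ρ_K(u) g(α_K(u)) / ψ(h_K(α_K(u)))`. A Lipschitz bound in
`ε`, uniform in `u`, allows dominated convergence (`tendsto_generalDualVolume`). The limit is an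
integral of `g ∘ α_K` against the curvature integrand. As `𝛂*_K(E)` is `α_K⁻¹(E)` up to a null set,
the curvature measure is the image under `α_K` of `1/n` times the integrand, and a change of
variables gives the right-hand side (`integral_dualOrliczCurvatureMeasure`). -/

/-- The hypotheses under which the Aleksandrov body `[f]` is a convex body with the origin in its
interior. -/
structure IsWulffData (Ω : Set (Sphere n)) (f : Sphere n → ℝ) : Prop where
  isCompact : IsCompact Ω
  nonempty : Ω.Nonempty
  exists_inner_pos : ∀ x : EuclideanSpace ℝ (Fin n), x ≠ 0 →
    ∃ v ∈ Ω, 0 < inner ℝ x (v : EuclideanSpace ℝ (Fin n))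
  continuousOn : ContinuousOn f Ω
  pos : ∀ u ∈ Ω, 0 < f u

/-- The gauge function `x ↦ max_{v ∈ Ω} ⟨x, v⟩ / f(v)` of the Aleksandrov body `[f]`. -/
def wulffGauge (Ω : Set (Sphere n)) (f : Sphere n → ℝ) (x : EuclideanSpace ℝ (Fin n)) : ℝ :=
  sSup ((fun v : Sphere n => inner ℝ x (v : EuclideanSpace ℝ (Fin n)) / f v) '' Ω)

lemma Sphere.norm_coe (u : Sphere n) : ‖(u : EuclideanSpace ℝ (Fin n))‖ = 1 := by simp

lemma Sphere.coe_ne_zero (u : Sphere n) : (u : EuclideanSpace ℝ (Fin n)) ≠ 0 := by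
  rw [← norm_ne_zero_iff, u.norm_coe]; exact one_ne_zero

lemma exists_inner_pos_of_not_subset_closedHemisphere {Ω : Set (Sphere n)}
    (hΩ : ∀ v : Sphere n, ¬ Ω ⊆ closedHemisphere v) (x : EuclideanSpace ℝ (Fin n)) (hx : x ≠ 0) :
    ∃ v ∈ Ω, 0 < inner ℝ x (v : EuclideanSpace ℝ (Fin n)) := by
  have hx' : 0 < ‖x‖ := norm_pos_iff.2 hx
  have hmem : -(‖x‖⁻¹ • x) ∈ Metric.sphere (0 : EuclideanSpace ℝ (Fin n)) 1 := by
    simp [norm_smul, hx'.ne']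
  -- A point of `Ω` outside the hemisphere centred at `-x / |x|` has positive inner product with
  -- `x`.
  obtain ⟨v, hv, hv'⟩ := not_subset.1 (hΩ ⟨_, hmem⟩)
  refine ⟨v, hv, ?_⟩
  simp only [closedHemisphere, mem_ofPred_eq, inner_neg_right, inner_smul_right, not_le,
    Left.neg_neg_iff] at hv'
  rw [real_inner_comm]
  exact pos_of_mul_pos_right hv' (inv_nonneg.2 hx'.le)

/-! ### The gauge of an Aleksandrov body and its radial Gauss map -/

namespace IsWulffData

variable {Ω : Set (Sphere n)} {f : Sphere n → ℝ} (H : IsWulffData Ω f)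
include H

lemma continuousOn_inner_div (x : EuclideanSpace ℝ (Fin n)) :
    ContinuousOn (fun v : Sphere n => inner ℝ x (v : EuclideanSpace ℝ (Fin n)) / f v) Ω :=
  ContinuousOn.div (by fun_prop) H.continuousOn fun v hv => (H.pos v hv).ne'

lemma isGreatest_wulffGauge (x : EuclideanSpace ℝ (Fin n)) :
    IsGreatest ((fun v : Sphere n => inner ℝ x (v : EuclideanSpace ℝ (Fin n)) / f v) '' Ω)
      (wulffGauge Ω f x) :=
  (H.isCompact.image_of_continuousOn (H.continuousOn_inner_div x)).isGreatest_sSup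
    (H.nonempty.image _)

lemma inner_div_le (x : EuclideanSpace ℝ (Fin n)) {v : Sphere n} (hv : v ∈ Ω) :
    inner ℝ x (v : EuclideanSpace ℝ (Fin n)) / f v ≤ wulffGauge Ω f x :=
  (H.isGreatest_wulffGauge x).2 ⟨v, hv, rfl⟩

lemma exists_eq_wulffGauge (x : EuclideanSpace ℝ (Fin n)) :
    ∃ v ∈ Ω, inner ℝ x (v : EuclideanSpace ℝ (Fin n)) / f v = wulffGauge Ω f x :=
  (H.isGreatest_wulffGauge x).1

lemma wulffGauge_pos {x : EuclideanSpace ℝ (Fin n)} (hx : x ≠ 0) : 0 < wulffGauge Ω f x := by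
  obtain ⟨v, hv, hvx⟩ := H.exists_inner_pos x hx
  exact (div_pos hvx (H.pos v hv)).trans_le (H.inner_div_le x hv)

lemma wulffGauge_smul {r : ℝ} (hr : 0 ≤ r) (x : EuclideanSpace ℝ (Fin n)) :
    wulffGauge Ω f (r • x) = r * wulffGauge Ω f x := by
  refine (H.isGreatest_wulffGauge (r • x)).unique ⟨?_, ?_⟩
  · obtain ⟨v, hv, h⟩ := H.exists_eq_wulffGauge x
    exact ⟨v, hv, by simp only [inner_smul_left, ← h, conj_trivial, mul_div_assoc]⟩
  · rintro _ ⟨v, hv, rfl⟩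
    simp only [inner_smul_left, conj_trivial, mul_div_assoc]
    exact mul_le_mul_of_nonneg_left (H.inner_div_le x hv) hr

lemma exists_le : ∃ m : ℝ, 0 < m ∧ ∀ v ∈ Ω, m ≤ f v := by
  obtain ⟨v, hv, h⟩ := H.isCompact.exists_isMinOn H.nonempty H.continuousOn
  exact ⟨f v, H.pos v hv, fun w hw => h hw⟩

/-- The gauge is a maximum of linear functionals of norm at most `1 / m`, where `m > 0` bounds `f`
from below on `Ω`. This is the input to Rademacher's theorem. -/
lemma exists_lipschitzWith : ∃ C, LipschitzWith C (wulffGauge Ω f) := by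
  obtain ⟨m, hm, hle⟩ := H.exists_le
  refine ⟨_, LipschitzWith.of_le_add_mul (Real.toNNReal m⁻¹) fun x y => ?_⟩
  rw [Real.coe_toNNReal _ (inv_nonneg.2 hm.le)]
  obtain ⟨v, hv, h⟩ := H.exists_eq_wulffGauge x
  have h1 : inner ℝ (x - y) (v : EuclideanSpace ℝ (Fin n)) / f v ≤ m⁻¹ * dist x y := by
    have : inner ℝ (x - y) (v : EuclideanSpace ℝ (Fin n)) ≤ dist x y := by
      simpa [dist_eq_norm] using real_inner_le_norm (x - y) (v : EuclideanSpace ℝ (Fin n))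
    calc _ ≤ dist x y / f v := div_le_div_of_nonneg_right this (H.pos v hv).le
      _ ≤ dist x y / m := div_le_div_of_nonneg_left dist_nonneg hm (hle v hv)
      _ = _ := by rw [div_eq_inv_mul]
  rw [inner_sub_left, sub_div] at h1
  linarith [H.inner_div_le y hv]

lemma continuous_wulffGauge : Continuous (wulffGauge Ω f) :=
  H.exists_lipschitzWith.choose_spec.continuous

lemma mem_aleksandrovBody_iff {x : EuclideanSpace ℝ (Fin n)} :
    x ∈ aleksandrovBody Ω f ↔ wulffGauge Ω f x ≤ 1 := by
  simp only [aleksandrovBody, mem_iInter, mem_ofPred_eq]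
  constructor
  · intro h
    obtain ⟨v, hv, hx⟩ := H.exists_eq_wulffGauge x
    rw [← hx, div_le_one (H.pos v hv)]
    exact h v hv
  · intro h v hv
    exact (div_le_one (H.pos v hv)).1 ((H.inner_div_le x hv).trans h)

lemma radialFn_eq (u : Sphere n) :
    radialFn (aleksandrovBody Ω f) u = (wulffGauge Ω f u)⁻¹ := by
  have hM := H.wulffGauge_pos u.coe_ne_zero
  have : {r : ℝ | 0 < r ∧ r • (u : EuclideanSpace ℝ (Fin n)) ∈ aleksandrovBody Ω f} =
      Ioc 0 (wulffGauge Ω f u)⁻¹ := by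
    ext r
    simp only [mem_ofPred_eq, mem_Ioc, and_congr_right_iff]
    intro hr
    rw [H.mem_aleksandrovBody_iff, H.wulffGauge_smul hr.le, ← le_div_iff₀ hM, one_div]
  rw [radialFn, this, csSup_Ioc (inv_pos.2 hM)]

lemma wulffGauge_radialFn_smul (u : Sphere n) :
    wulffGauge Ω f (radialFn (aleksandrovBody Ω f) u • (u : EuclideanSpace ℝ (Fin n))) = 1 := by
  have hM := H.wulffGauge_pos u.coe_ne_zero
  rw [H.radialFn_eq, H.wulffGauge_smul (inv_nonneg.2 hM.le), inv_mul_cancel₀ hM.ne']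

lemma radialFn_pos (u : Sphere n) : 0 < radialFn (aleksandrovBody Ω f) u := by
  rw [H.radialFn_eq]
  exact inv_pos.2 (H.wulffGauge_pos u.coe_ne_zero)

lemma mem_frontier_iff {x : EuclideanSpace ℝ (Fin n)} :
    x ∈ frontier (aleksandrovBody Ω f) ↔ wulffGauge Ω f x = 1 := by
  have hK : aleksandrovBody Ω f = {x | wulffGauge Ω f x ≤ 1} :=
    ext fun x => H.mem_aleksandrovBody_iff
  constructor
  · rw [hK]
    exact fun h => frontier_le_subset_eq H.continuous_wulffGauge continuous_const h
  · intro hx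
    refine ⟨subset_closure (H.mem_aleksandrovBody_iff.2 hx.le), fun hint => ?_⟩
    -- The points `r • x` with `r > 1` have gauge `r > 1` and tend to `x`, so `x` cannot be
    -- interior.
    have h1 : Tendsto (fun r : ℝ => r • x) (𝓝[>] 1) (𝓝 x) := by
      have : Tendsto (fun r : ℝ => r • x) (𝓝 1) (𝓝 ((1 : ℝ) • x)) :=
        (continuous_id.smul continuous_const).tendsto 1
      rw [one_smul] at this
      exact this.mono_left nhdsWithin_le_nhds
    obtain ⟨r, hr, hr1⟩ := ((h1.eventually (mem_interior_iff_mem_nhds.1 hint)).and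
      self_mem_nhdsWithin).exists
    have hr0 : (0 : ℝ) ≤ r := (zero_lt_one.trans hr1).le
    have := H.mem_aleksandrovBody_iff.1 hr
    rw [H.wulffGauge_smul hr0, hx, mul_one] at this
    exact absurd hr1 (not_lt.2 this)

lemma exists_le_wulffGauge : ∃ c : ℝ, 0 < c ∧ ∀ u : Sphere n, c ≤ wulffGauge Ω f u := by
  obtain ⟨v, -⟩ := H.nonempty
  obtain ⟨w, -, hw⟩ := isCompact_univ.exists_isMinOn
    (⟨v, mem_univ v⟩ : (univ : Set (Sphere n)).Nonempty)
    (H.continuous_wulffGauge.comp continuous_subtype_val).continuousOn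
  exact ⟨wulffGauge Ω f w, H.wulffGauge_pos w.coe_ne_zero, fun u => hw (mem_univ u)⟩

lemma exists_mul_norm_le_wulffGauge :
    ∃ c : ℝ, 0 < c ∧ ∀ x : EuclideanSpace ℝ (Fin n), c * ‖x‖ ≤ wulffGauge Ω f x := by
  obtain ⟨c, hc, hle⟩ := H.exists_le_wulffGauge
  refine ⟨c, hc, fun x => ?_⟩
  rcases eq_or_ne x 0 with rfl | hx0
  · have : wulffGauge Ω f 0 = 0 := by
      simpa using H.wulffGauge_smul le_rfl (0 : EuclideanSpace ℝ (Fin n))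
    simp [this]
  have hxn : 0 < ‖x‖ := norm_pos_iff.2 hx0
  have hmem : ‖x‖⁻¹ • x ∈ Metric.sphere (0 : EuclideanSpace ℝ (Fin n)) 1 := by
    simp [norm_smul, hxn.ne']
  have h1 : c ≤ wulffGauge Ω f (‖x‖⁻¹ • x) := hle ⟨_, hmem⟩
  rw [H.wulffGauge_smul (inv_nonneg.2 hxn.le), le_inv_mul_iff₀ hxn] at h1
  linarith

lemma bddAbove_inner_image (u : Sphere n) :
    BddAbove ((fun x => inner ℝ (u : EuclideanSpace ℝ (Fin n)) x) '' aleksandrovBody Ω f) := by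
  obtain ⟨c, hc, hle⟩ := H.exists_mul_norm_le_wulffGauge
  refine ⟨c⁻¹, forall_mem_image.2 fun x hx => ?_⟩
  have hux : inner ℝ (u : EuclideanSpace ℝ (Fin n)) x ≤ ‖x‖ := by
    simpa using real_inner_le_norm (u : EuclideanSpace ℝ (Fin n)) x
  refine hux.trans ?_
  rw [← one_div, le_div_iff₀' hc]
  exact (hle x).trans (H.mem_aleksandrovBody_iff.1 hx)

lemma inner_le_supportFn {x : EuclideanSpace ℝ (Fin n)} (hx : x ∈ aleksandrovBody Ω f)
    (v : Sphere n) :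
    inner ℝ x (v : EuclideanSpace ℝ (Fin n)) ≤ supportFn (aleksandrovBody Ω f) v := by
  rw [real_inner_comm]
  exact le_csSup (H.bddAbove_inner_image v) ⟨x, hx, rfl⟩

/-- Rescale `x` to gauge `1` and use the definition of the support function. In this homogeneous
form the inequality holds on the whole space, so equality at a point is a minimum condition to which
Fermat's rule applies. -/
lemma inner_le_mul_supportFn (x : EuclideanSpace ℝ (Fin n)) (v : Sphere n) :
    inner ℝ x (v : EuclideanSpace ℝ (Fin n)) ≤
      wulffGauge Ω f x * supportFn (aleksandrovBody Ω f) v := by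
  rcases eq_or_ne x 0 with rfl | hx0
  · have : wulffGauge Ω f 0 = 0 := by
      simpa using H.wulffGauge_smul le_rfl (0 : EuclideanSpace ℝ (Fin n))
    simp [this]
  have hM := H.wulffGauge_pos hx0
  have h1 : (wulffGauge Ω f x)⁻¹ • x ∈ aleksandrovBody Ω f := by
    rw [H.mem_aleksandrovBody_iff, H.wulffGauge_smul (inv_nonneg.2 hM.le), inv_mul_cancel₀ hM.ne']
  have h2 := H.inner_le_supportFn h1 v
  rwa [inner_smul_left, conj_trivial, inv_mul_le_iff₀ hM] at h2

lemma supportFn_pos (v : Sphere n) : 0 < supportFn (aleksandrovBody Ω f) v := by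
  have h := H.inner_le_mul_supportFn v v
  rw [real_inner_self_eq_norm_sq, v.norm_coe, one_pow] at h
  exact pos_of_mul_pos_right (zero_lt_one.trans_le h) (H.wulffGauge_pos v.coe_ne_zero).le

lemma supportFn_le {v : Sphere n} (hv : v ∈ Ω) : supportFn (aleksandrovBody Ω f) v ≤ f v := by
  refine csSup_le ⟨_, 0, ?_, rfl⟩ ?_
  · simp only [aleksandrovBody, mem_iInter, mem_ofPred_eq, inner_zero_left]
    exact fun w hw => (H.pos w hw).le
  · rintro _ ⟨x, hx, rfl⟩
    simp only [aleksandrovBody, mem_iInter, mem_ofPred_eq] at hx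
    simpa only [real_inner_comm] using hx v hv

lemma mem_radialGaussImage_iff {u v : Sphere n} :
    v ∈ radialGaussImage (aleksandrovBody Ω f) {u} ↔
      inner ℝ (u : EuclideanSpace ℝ (Fin n)) (v : EuclideanSpace ℝ (Fin n)) =
        wulffGauge Ω f u * supportFn (aleksandrovBody Ω f) v := by
  have hM := H.wulffGauge_pos u.coe_ne_zero
  have key : inner ℝ (radialFn (aleksandrovBody Ω f) u • (u : EuclideanSpace ℝ (Fin n)))
      (v : EuclideanSpace ℝ (Fin n)) = supportFn (aleksandrovBody Ω f) v ↔
      inner ℝ (u : EuclideanSpace ℝ (Fin n)) (v : EuclideanSpace ℝ (Fin n)) =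
        wulffGauge Ω f u * supportFn (aleksandrovBody Ω f) v := by
    rw [H.radialFn_eq, inner_smul_left, conj_trivial, inv_mul_eq_iff_eq_mul₀ hM.ne']
  rw [← key]
  simp only [radialGaussImage, sphericalImage, supportHyperplane, mem_ofPred_eq, mem_singleton_iff,
    exists_eq_left]
  constructor
  · rintro ⟨x, ⟨-, rfl⟩, h⟩
    exact h
  · intro h
    exact ⟨_, ⟨H.mem_frontier_iff.2 (H.wulffGauge_radialFn_smul u), rfl⟩, h⟩

/-- A constraint that attains the maximum is active: its hyperplane touches the body. This is what
turns `h₀(α_K(u))` into `h_K(α_K(u))` in the final formula. -/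
lemma supportFn_eq_of_eq_wulffGauge {u v : Sphere n} (hv : v ∈ Ω)
    (h : inner ℝ (u : EuclideanSpace ℝ (Fin n)) (v : EuclideanSpace ℝ (Fin n)) / f v =
      wulffGauge Ω f u) : supportFn (aleksandrovBody Ω f) v = f v := by
  have hM := H.wulffGauge_pos u.coe_ne_zero
  refine (H.supportFn_le hv).antisymm ?_
  rw [div_eq_iff (H.pos v hv).ne'] at h
  have := H.inner_le_mul_supportFn u v
  rw [h] at this
  exact le_of_mul_le_mul_left this hM

lemma mem_radialGaussImage_of_eq_wulffGauge {u v : Sphere n} (hv : v ∈ Ω)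
    (h : inner ℝ (u : EuclideanSpace ℝ (Fin n)) (v : EuclideanSpace ℝ (Fin n)) / f v =
      wulffGauge Ω f u) : v ∈ radialGaussImage (aleksandrovBody Ω f) {u} := by
  rw [H.mem_radialGaussImage_iff, H.supportFn_eq_of_eq_wulffGauge hv h]
  exact (div_eq_iff (H.pos v hv).ne').1 h

lemma radialGaussMap_mem (u : Sphere n) :
    radialGaussMap (aleksandrovBody Ω f) u ∈ radialGaussImage (aleksandrovBody Ω f) {u} := by
  obtain ⟨v, hv, h⟩ := H.exists_eq_wulffGauge u
  have hne : (radialGaussImage (aleksandrovBody Ω f) {u}).Nonempty :=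
    ⟨v, H.mem_radialGaussImage_of_eq_wulffGauge hv h⟩
  rw [radialGaussMap, dif_pos hne]
  exact hne.choose_spec

/-- If `v` is a normal at direction `u`, the nonnegative function `D = s M - ⟨v, ·⟩` vanishes at
`u`. Fermat's rule gives `s ∇M(u) = v`, and `|v| = 1` determines `s`. -/
lemma coe_eq_of_mem_radialGaussImage {u v : Sphere n}
    (hd : DifferentiableAt ℝ (wulffGauge Ω f) (u : EuclideanSpace ℝ (Fin n)))
    (hv : v ∈ radialGaussImage (aleksandrovBody Ω f) {u}) :
    (v : EuclideanSpace ℝ (Fin n)) =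
      ‖gradient (wulffGauge Ω f) u‖⁻¹ • gradient (wulffGauge Ω f) u := by
  have hs := H.supportFn_pos v
  set s := supportFn (aleksandrovBody Ω f) v
  rw [H.mem_radialGaussImage_iff] at hv
  let D : EuclideanSpace ℝ (Fin n) → ℝ := fun x =>
    wulffGauge Ω f x * s - innerSL ℝ (v : EuclideanSpace ℝ (Fin n)) x
  have hmin : IsLocalMin D (u : EuclideanSpace ℝ (Fin n)) := by
    refine Eventually.of_forall fun x => ?_
    have h1 := H.inner_le_mul_supportFn x v
    simp only [D, innerSL_apply_apply]
    rw [real_inner_comm, hv, real_inner_comm, sub_self]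
    exact sub_nonneg.2 h1
  have hD := (hd.hasFDerivAt.mul_const s).sub
    (innerSL ℝ (v : EuclideanSpace ℝ (Fin n))).hasFDerivAt
  have h0 := hmin.hasFDerivAt_eq_zero hD
  have hgrad : s • gradient (wulffGauge Ω f) u = (v : EuclideanSpace ℝ (Fin n)) := by
    refine ext_inner_right ℝ fun y => ?_
    have h2 := congrArg (fun L : EuclideanSpace ℝ (Fin n) →L[ℝ] ℝ => L y) (sub_eq_zero.1 h0)
    simp only [smul_apply, innerSL_apply_apply, smul_eq_mul] at h2
    rw [inner_smul_left, conj_trivial, ← h2, gradient, InnerProductSpace.toDual_symm_apply]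
  have hn : s * ‖gradient (wulffGauge Ω f) u‖ = 1 := by
    have := v.norm_coe
    rwa [← hgrad, norm_smul, Real.norm_of_nonneg hs.le] at this
  rw [← hgrad, ← eq_inv_of_mul_eq_one_left hn]

lemma eq_radialGaussMap {u v : Sphere n}
    (hd : DifferentiableAt ℝ (wulffGauge Ω f) (u : EuclideanSpace ℝ (Fin n)))
    (hv : v ∈ radialGaussImage (aleksandrovBody Ω f) {u}) :
    v = radialGaussMap (aleksandrovBody Ω f) u :=
  Subtype.ext <| (H.coe_eq_of_mem_radialGaussImage hd hv).trans
    (H.coe_eq_of_mem_radialGaussImage hd (H.radialGaussMap_mem u)).symm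

/-- Some maximiser exists in `Ω` and is an outer normal; uniqueness of the normal identifies it with
the chosen one. -/
lemma radialGaussMap_spec {u : Sphere n}
    (hd : DifferentiableAt ℝ (wulffGauge Ω f) (u : EuclideanSpace ℝ (Fin n))) :
    radialGaussMap (aleksandrovBody Ω f) u ∈ Ω ∧
      inner ℝ (u : EuclideanSpace ℝ (Fin n))
        (radialGaussMap (aleksandrovBody Ω f) u : EuclideanSpace ℝ (Fin n)) /
        f (radialGaussMap (aleksandrovBody Ω f) u) = wulffGauge Ω f u := by
  obtain ⟨v, hv, h⟩ := H.exists_eq_wulffGauge u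
  rw [← H.eq_radialGaussMap hd (H.mem_radialGaussImage_of_eq_wulffGauge hv h)]
  exact ⟨hv, h⟩

lemma mem_reverseRadialGaussImage_iff {u : Sphere n} {S : Set (Sphere n)}
    (hd : DifferentiableAt ℝ (wulffGauge Ω f) (u : EuclideanSpace ℝ (Fin n))) :
    u ∈ reverseRadialGaussImage (aleksandrovBody Ω f) S ↔
      radialGaussMap (aleksandrovBody Ω f) u ∈ S := by
  constructor
  · rintro ⟨x, ⟨hx, v, hvS, hxv⟩, hu⟩
    have hM := H.mem_frontier_iff.1 hx
    have hx0 : x ≠ 0 := by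
      rintro rfl
      exact u.coe_ne_zero (by rw [hu, smul_zero])
    have hxn : 0 < ‖x‖ := norm_pos_iff.2 hx0
    rw [← H.eq_radialGaussMap (v := v) hd]
    · exact hvS
    rw [H.mem_radialGaussImage_iff, hu, H.wulffGauge_smul (inv_nonneg.2 hxn.le), hM, mul_one,
      inner_smul_left, conj_trivial]
    rw [show inner ℝ x (v : EuclideanSpace ℝ (Fin n)) = _ from hxv]
  · intro hS
    have hr := H.radialFn_pos u
    have h := H.radialGaussMap_mem u
    rw [H.mem_radialGaussImage_iff] at h
    refine ⟨radialFn (aleksandrovBody Ω f) u • (u : EuclideanSpace ℝ (Fin n)),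
      ⟨H.mem_frontier_iff.2 (H.wulffGauge_radialFn_smul u), _, hS, ?_⟩, ?_⟩
    · rw [supportHyperplane, mem_ofPred_eq, inner_smul_left, conj_trivial, h, H.radialFn_eq,
        inv_mul_cancel_left₀ (H.wulffGauge_pos u.coe_ne_zero).ne']
    · rw [norm_smul, u.norm_coe, mul_one, Real.norm_of_nonneg hr.le, smul_smul,
        inv_mul_cancel₀ hr.ne', one_smul]

/-- The spherical measure of `S` is a multiple of the volume of the cone `(0, 1) • S`.
Non-differentiability at `u` propagates to all `r • u` with `r > 0` by homogeneity, so that cone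
lies in the null set of Rademacher's theorem. -/
lemma ae_differentiableAt :
    ∀ᵐ u : Sphere n ∂sphereMeasure n,
      DifferentiableAt ℝ (wulffGauge Ω f) (u : EuclideanSpace ℝ (Fin n)) := by
  obtain ⟨C, hC⟩ := H.exists_lipschitzWith
  have hae := hC.ae_differentiableAt (μ := (volume : Measure (EuclideanSpace ℝ (Fin n))))
  let S : Set (Sphere n) :=
    Subtype.val ⁻¹' {x | DifferentiableAt ℝ (wulffGauge Ω f) x}ᶜ
  have hS : MeasurableSet S :=
    measurable_subtype_coe (measurableSet_of_differentiableAt ℝ (wulffGauge Ω f)).compl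
  change sphereMeasure n S = 0
  rw [sphereMeasure, Measure.toSphere_apply' _ hS]
  refine mul_eq_zero_of_right _ (measure_mono_null ?_ (ae_iff.1 hae))
  rintro _ ⟨r, hr, _, ⟨u, hu, rfl⟩, rfl⟩ hd
  refine hu ?_
  have hd' : DifferentiableAt ℝ (fun x => r⁻¹ * wulffGauge Ω f (r • x))
      (u : EuclideanSpace ℝ (Fin n)) := by
    refine DifferentiableAt.const_mul ?_ _
    exact DifferentiableAt.comp (u : EuclideanSpace ℝ (Fin n)) (g := wulffGauge Ω f) hd
      (differentiableAt_id.const_smul r)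
  refine hd'.congr_of_eventuallyEq (Eventually.of_forall fun x => ?_)
  change _ = r⁻¹ * wulffGauge Ω f (r • x)
  rw [H.wulffGauge_smul hr.1.le, inv_mul_cancel_left₀ hr.1.ne']

/-- The map is defined by choice, but almost everywhere it equals the normalised gradient of the
gauge, which is Borel. -/
lemma aemeasurable_radialGaussMap :
    AEMeasurable (radialGaussMap (aleksandrovBody Ω f)) (sphereMeasure n) := by
  have hs : MeasurableSet (Metric.sphere (0 : EuclideanSpace ℝ (Fin n)) 1) :=
    Metric.isClosed_sphere.measurableSet
  rw [← (MeasurableEmbedding.subtype_coe hs).aemeasurable_comp_iff]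
  have hg : Measurable (gradient (wulffGauge Ω f)) :=
    (InnerProductSpace.toDual ℝ (EuclideanSpace ℝ (Fin n))).symm.continuous.measurable.comp
      (measurable_fderiv ℝ _)
  refine ⟨fun u => ‖gradient (wulffGauge Ω f) u‖⁻¹ • gradient (wulffGauge Ω f) u, ?_, ?_⟩
  · exact (hg.norm.inv.smul hg).comp measurable_subtype_coe
  · filter_upwards [H.ae_differentiableAt] with u hu
    exact H.coe_eq_of_mem_radialGaussImage hu (H.radialGaussMap_mem u)

end IsWulffData

/-! ### Maxima over a compact set, and local inversion of `φ` -/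

/-- An envelope theorem: if the maximum of `F 0` over the compact set `Ω` is attained at `v` only,
then `ε ↦ max_Ω (F ε)` is differentiable at `0`, with derivative `∂F/∂ε (0, v)`. -/
lemma hasDerivAt_of_isGreatest_image {X : Type*} [TopologicalSpace X] [T2Space X] {Ω : Set X}
    (hΩ : IsCompact Ω) {F : ℝ → X → ℝ} {p : X → ℝ} {M : ℝ → ℝ} {v : X} (hv : v ∈ Ω)
    (hF : ContinuousOn (F 0) Ω) (hp : ContinuousOn p Ω)
    (hM : ∀ᶠ ε in 𝓝 (0 : ℝ), IsGreatest (F ε '' Ω) (M ε))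
    (hmax : ∀ w ∈ Ω, F 0 w = M 0 → w = v)
    (hexp : ∀ η > 0, ∀ᶠ ε in 𝓝 (0 : ℝ), ∀ w ∈ Ω, |F ε w - F 0 w - ε * p w| ≤ η * |ε|) :
    HasDerivAt M (p v) 0 := by
  rw [hasDerivAt_iff_isLittleO, Asymptotics.isLittleO_iff]
  intro c hc
  have hM0 := hM.self_of_nhds
  have hFv : F 0 v = M 0 := by
    obtain ⟨w, hw, h⟩ := hM0.1
    rwa [← hmax w hw h]
  obtain ⟨B, hB⟩ := hΩ.exists_bound_of_continuousOn hp
  have hB0 : 0 ≤ B := (norm_nonneg _).trans (hB v hv)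
  -- `S` consists of the points where `p` is not within `c / 2` of `p v`. It is compact and misses
  -- the unique maximiser, so `F 0` stays below `M 0` by a fixed `δ` on it.
  let S : Set X := Ω ∩ (fun w => |p w - p v|) ⁻¹' Ici (c / 2)
  have hS : IsCompact S := hΩ.of_isClosed_subset
    ((hp.sub continuousOn_const).abs.preimage_isClosed_of_isClosed hΩ.isClosed isClosed_Ici)
    inter_subset_left
  obtain ⟨δ, hδ, hSδ⟩ : ∃ δ > 0, ∀ w ∈ S, F 0 w ≤ M 0 - δ := by
    rcases S.eq_empty_or_nonempty with h | h
    · exact ⟨1, one_pos, by simp [h]⟩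
    · obtain ⟨w, hw, hwmax⟩ := hS.exists_isMaxOn h (hF.mono inter_subset_left)
      have hle : F 0 w ≤ M 0 := hM0.2 ⟨w, hw.1, rfl⟩
      have hne : F 0 w ≠ M 0 := by
        intro heq
        have h1 : c / 2 ≤ |p w - p v| := hw.2
        rw [hmax w hw.1 heq, sub_self, abs_zero] at h1
        linarith
      refine ⟨M 0 - F 0 w, sub_pos.2 (hle.lt_of_ne hne), fun w' hw' => ?_⟩
      have : F 0 w' ≤ F 0 w := hwmax hw'
      linarith
  have hsmall : ∀ᶠ ε in 𝓝 (0 : ℝ), (B + 1) * |ε| < δ / 2 := by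
    have : Tendsto (fun ε : ℝ => (B + 1) * |ε|) (𝓝 0) (𝓝 ((B + 1) * |0|)) :=
      (continuous_const.mul continuous_abs).tendsto 0
    rw [abs_zero, mul_zero] at this
    exact this.eventually (gt_mem_nhds (half_pos hδ))
  filter_upwards [hM, hsmall, hexp 1 one_pos, hexp (c / 2) (half_pos hc)] with ε hMε hε h1 h2
  -- The expansion with `η = 1` gives `|F ε w - F 0 w| ≤ (1 + B) |ε|`. Values move by less than `δ /
  -- 2`, so no maximiser of `F ε` lies in `S`.
  have hdiff : ∀ w ∈ Ω, |F ε w - F 0 w| < δ / 2 := by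
    intro w hw
    have h3 := abs_add_le (F ε w - F 0 w - ε * p w) (ε * p w)
    rw [sub_add_cancel, abs_mul] at h3
    have h4 : |ε| * |p w| ≤ |ε| * B := mul_le_mul_of_nonneg_left (hB w hw) (abs_nonneg _)
    linarith [h1 w hw]
  obtain ⟨w, hw, hwM⟩ := hMε.1
  have hvM : F ε v ≤ M ε := hMε.2 ⟨v, hv, rfl⟩
  have hpw : |p w - p v| < c / 2 := by
    by_contra hcon
    have h3 := hSδ w ⟨hw, not_lt.1 hcon⟩
    have h4 := abs_lt.1 (hdiff w hw)
    have h5 := abs_lt.1 (hdiff v hv)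
    linarith [h4.2, h5.1]
  have h3 := abs_le.1 (h2 w hw)
  have h4 := abs_le.1 (h2 v hv)
  have h5 : |ε * (p w - p v)| ≤ |ε| * (c / 2) := by
    rw [abs_mul]
    exact mul_le_mul_of_nonneg_left hpw.le (abs_nonneg _)
  have h6 := abs_le.1 h5
  have h7 : F 0 w ≤ M 0 := hM0.2 ⟨w, hw, rfl⟩
  rw [sub_zero, smul_eq_mul, Real.norm_eq_abs, Real.norm_eq_abs, abs_le]
  -- The squeeze is `F ε v - F 0 v ≤ M ε - M 0 ≤ F ε w - F 0 w`. Each side costs `c / 2 * |ε|` from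
  -- the expansion, and the upper one another `c / 2 * |ε|` for replacing `p w` by `p v`.
  constructor <;> nlinarith [abs_nonneg ε]

/-- A tube lemma relative to `K`: the local conditions use only neighbourhoods within `K`, because
`h₀` and `g` are continuous only on `Ω`. -/
lemma eventually_forall_mem_of_nhdsWithin {X Y : Type*} [TopologicalSpace X] [TopologicalSpace Y]
    {x₀ : X} {K : Set Y} (hK : IsCompact K) {P : X → Y → Prop}
    (hP : ∀ y ∈ K, ∀ᶠ z : X × Y in 𝓝 x₀ ×ˢ 𝓝[K] y, P z.1 z.2) :
    ∀ᶠ x in 𝓝 x₀, ∀ y ∈ K, P x y := by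
  have := hK.eventually_forall_of_forall_eventually (x₀ := x₀) (P := fun x y => y ∈ K → P x y) ?_
  · filter_upwards [this] with x hx y hy using hx y hy hy
  · intro y hy
    have h := hP y hy
    rw [← nhdsWithin_univ x₀, ← nhdsWithin_prod_eq, eventually_nhdsWithin_iff] at h
    filter_upwards [h] with z hz hzK using hz ⟨mem_univ _, hzK⟩

lemma hasStrictDerivAt_of_contDiffOn {φ : ℝ → ℝ} (hφ : ContDiffOn ℝ 1 φ (Ioi 0)) {t : ℝ}
    (ht : 0 < t) : HasStrictDerivAt φ (deriv φ t) t :=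
  (hφ.contDiffAt (Ioi_mem_nhds ht)).hasStrictDerivAt one_ne_zero

/-- Strictness is essential: the uniform expansion later compares values at two points that both
vary near `φ t`. -/
lemma hasStrictDerivAt_invFunOn {φ : ℝ → ℝ} (hφ : ContDiffOn ℝ 1 φ (Ioi 0))
    (hinj : InjOn φ (Ioi 0)) {t : ℝ} (ht : 0 < t) (hd : deriv φ t ≠ 0) :
    HasStrictDerivAt (Function.invFunOn φ (Ioi 0)) (deriv φ t)⁻¹ (φ t) := by
  refine (hasStrictDerivAt_of_contDiffOn hφ ht).to_local_left_inverse hd ?_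
  filter_upwards [Ioi_mem_nhds ht] with s hs using hinj.leftInvOn_invFunOn hs

lemma image_Ioi_mem_nhds {φ : ℝ → ℝ} (hφ : ContDiffOn ℝ 1 φ (Ioi 0)) {t : ℝ} (ht : 0 < t)
    (hd : deriv φ t ≠ 0) : φ '' Ioi 0 ∈ 𝓝 (φ t) := by
  rw [← (hasStrictDerivAt_of_contDiffOn hφ ht).map_nhds_eq hd]
  exact image_mem_map (Ioi_mem_nhds ht)

/-! ### The Orlicz perturbation to first order, uniformly on `Ω` -/

/-- The hypotheses on an Orlicz perturbation `φ⁻¹(φ(h₀) + ε g)`. -/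
structure IsPerturbationData (Ω : Set (Sphere n)) (φ : ℝ → ℝ) (h₀ g : Sphere n → ℝ) : Prop where
  wulff : IsWulffData Ω h₀
  continuousOn_g : ContinuousOn g Ω
  contDiffOn : ContDiffOn ℝ 1 φ (Ioi 0)
  injOn : InjOn φ (Ioi 0)
  deriv_ne_zero : ∀ t : ℝ, 0 < t → deriv φ t ≠ 0

/-- The derivative of `ε ↦ 1 / φ⁻¹(φ(h₀(u)) + ε g(u))` at `0`. -/
def invPerturbationDeriv (φ : ℝ → ℝ) (h₀ g : Sphere n → ℝ) (u : Sphere n) : ℝ :=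
  g u * (-(deriv φ (h₀ u))⁻¹ / h₀ u ^ 2)

namespace IsPerturbationData

variable {Ω : Set (Sphere n)} {φ : ℝ → ℝ} {h₀ g : Sphere n → ℝ}
  (H : IsPerturbationData Ω φ h₀ g)
include H

lemma continuousOn_deriv_comp : ContinuousOn (fun u => deriv φ (h₀ u)) Ω :=
  (H.contDiffOn.continuousOn_deriv_of_isOpen isOpen_Ioi le_rfl).comp H.wulff.continuousOn
    fun u hu => H.wulff.pos u hu

lemma continuousOn_comp : ContinuousOn (fun u => φ (h₀ u)) Ω :=
  H.contDiffOn.continuousOn.comp H.wulff.continuousOn fun u hu => H.wulff.pos u hu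

lemma continuousOn_invPerturbationDeriv : ContinuousOn (invPerturbationDeriv φ h₀ g) Ω :=
  H.continuousOn_g.mul <| (H.continuousOn_deriv_comp.inv₀ fun u hu =>
    H.deriv_ne_zero _ (H.wulff.pos u hu)).neg.div (H.wulff.continuousOn.pow 2) fun u hu =>
      pow_ne_zero 2 (H.wulff.pos u hu).ne'

lemma invFunOn_comp {u : Sphere n} (hu : u ∈ Ω) :
    Function.invFunOn φ (Ioi 0) (φ (h₀ u)) = h₀ u :=
  H.injOn.leftInvOn_invFunOn (H.wulff.pos u hu)

lemma orliczPerturbation_zero {u : Sphere n} (hu : u ∈ Ω) :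
    orliczPerturbation φ h₀ g 0 u = h₀ u := by
  rw [orliczPerturbation, zero_mul, add_zero, H.invFunOn_comp hu]

lemma tendsto_comp_add {y : Sphere n} (hy : y ∈ Ω) :
    Tendsto (fun z : ℝ × Sphere n => φ (h₀ z.2) + z.1 * g z.2) (𝓝 0 ×ˢ 𝓝[Ω] y)
      (𝓝 (φ (h₀ y))) := by
  have h1 : Tendsto (fun z : ℝ × Sphere n => φ (h₀ z.2)) (𝓝 0 ×ˢ 𝓝[Ω] y) (𝓝 (φ (h₀ y))) :=
    (H.continuousOn_comp y hy).tendsto.comp tendsto_snd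
  have h2 : Tendsto (fun z : ℝ × Sphere n => g z.2) (𝓝 0 ×ˢ 𝓝[Ω] y) (𝓝 (g y)) :=
    (H.continuousOn_g y hy).tendsto.comp tendsto_snd
  simpa using h1.add ((tendsto_fst (f := 𝓝 (0 : ℝ)) (g := 𝓝[Ω] y)).mul h2)

lemma eventually_mem_image :
    ∀ᶠ ε in 𝓝 (0 : ℝ), ∀ u ∈ Ω, φ (h₀ u) + ε * g u ∈ φ '' Ioi 0 :=
  eventually_forall_mem_of_nhdsWithin H.wulff.isCompact fun y hy =>
    (H.tendsto_comp_add hy).eventually <|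
      image_Ioi_mem_nhds H.contDiffOn (H.wulff.pos y hy) (H.deriv_ne_zero _ (H.wulff.pos y hy))

lemma isWulffData_orliczPerturbation {ε : ℝ}
    (hε : ∀ u ∈ Ω, φ (h₀ u) + ε * g u ∈ φ '' Ioi 0) :
    IsWulffData Ω (orliczPerturbation φ h₀ g ε) where
  isCompact := H.wulff.isCompact
  nonempty := H.wulff.nonempty
  exists_inner_pos := H.wulff.exists_inner_pos
  continuousOn := by
    have hc : ContinuousOn (Function.invFunOn φ (Ioi 0)) (φ '' Ioi 0) := by
      rintro _ ⟨t, ht, rfl⟩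
      exact (hasStrictDerivAt_invFunOn H.contDiffOn H.injOn ht
        (H.deriv_ne_zero t ht)).hasDerivAt.continuousAt.continuousWithinAt
    exact hc.comp (H.continuousOn_comp.add (continuousOn_const.mul H.continuousOn_g)) hε
  pos u hu := Function.invFunOn_mem (hε u hu)

/-- Near each `y ∈ Ω`, strict differentiability of `1 / φ⁻¹` at `φ(h₀ y)` gives an expansion with
the slope `b` frozen at `y`. Continuity allows `b` to vary with the point, and compactness makes the
neighbourhoods uniform. -/
lemma eventually_inv_expansion {η : ℝ} (hη : 0 < η) :
    ∀ᶠ ε in 𝓝 (0 : ℝ), ∀ u ∈ Ω, |(orliczPerturbation φ h₀ g ε u)⁻¹ - (h₀ u)⁻¹ -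
      ε * invPerturbationDeriv φ h₀ g u| ≤ η * |ε| := by
  refine eventually_forall_mem_of_nhdsWithin H.wulff.isCompact fun y hy => ?_
  have hpos := H.wulff.pos y hy
  have hstrict := hasStrictDerivAt_invFunOn H.contDiffOn H.injOn hpos (H.deriv_ne_zero _ hpos)
  set b := -(deriv φ (h₀ y))⁻¹ / h₀ y ^ 2 with hb
  have hinv : HasStrictDerivAt (fun s => (Function.invFunOn φ (Ioi 0) s)⁻¹) b (φ (h₀ y)) := by
    have h := hasStrictDerivAt_inv hpos.ne'
    rw [← H.invFunOn_comp hy] at h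
    have := h.comp (φ (h₀ y)) hstrict
    rw [H.invFunOn_comp hy] at this
    exact this.congr_deriv (by rw [hb, div_eq_mul_inv, neg_mul, neg_mul, mul_comm])
  have hg : Tendsto (fun z : ℝ × Sphere n => g z.2) (𝓝 0 ×ˢ 𝓝[Ω] y) (𝓝 (g y)) :=
    (H.continuousOn_g y hy).tendsto.comp tendsto_snd
  have hd : Tendsto (fun z : ℝ × Sphere n => g z.2 * b - invPerturbationDeriv φ h₀ g z.2)
      (𝓝 0 ×ˢ 𝓝[Ω] y) (𝓝 0) := by
    have := (hg.mul_const b).sub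
      ((H.continuousOn_invPerturbationDeriv y hy).tendsto.comp
        (tendsto_snd (f := 𝓝 (0 : ℝ)) (g := 𝓝[Ω] y)))
    rwa [invPerturbationDeriv, ← hb, sub_self] at this
  have hT0 : Tendsto (fun z : ℝ × Sphere n => φ (h₀ z.2)) (𝓝 0 ×ˢ 𝓝[Ω] y) (𝓝 (φ (h₀ y))) :=
    (H.continuousOn_comp y hy).tendsto.comp tendsto_snd
  have hpair := (H.tendsto_comp_add hy).prodMk_nhds hT0
  -- The increment is `ε g`, with `|g| < |g y| + 1` near `y`; this constant makes the
  -- strict-derivative error at most `η / 2 * |ε|`. The other half of `η` pays for unfreezing `b`.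
  have hc : 0 < η / 2 / (|g y| + 1) := by positivity
  have ho := hpair.eventually ((Asymptotics.isLittleO_iff.1 hinv.isLittleO) hc)
  have hgb : ∀ᶠ z : ℝ × Sphere n in 𝓝 0 ×ˢ 𝓝[Ω] y, |g z.2| < |g y| + 1 :=
    hg.abs.eventually (gt_mem_nhds (lt_add_one _))
  have hdb : ∀ᶠ z : ℝ × Sphere n in 𝓝 0 ×ˢ 𝓝[Ω] y,
      |g z.2 * b - invPerturbationDeriv φ h₀ g z.2| < η / 2 := by
    have := hd.abs
    rw [abs_zero] at this
    exact this.eventually (gt_mem_nhds (half_pos hη))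
  have hmem : ∀ᶠ z : ℝ × Sphere n in 𝓝 0 ×ˢ 𝓝[Ω] y, z.2 ∈ Ω :=
    tendsto_snd.eventually self_mem_nhdsWithin
  filter_upwards [ho, hgb, hdb, hmem] with z h1 h2 h3 h4
  simp only [add_sub_cancel_left, H.invFunOn_comp h4, Real.norm_eq_abs, abs_mul] at h1
  have e1 : η / 2 / (|g y| + 1) * (|z.1| * |g z.2|) ≤ η / 2 * |z.1| := by
    have : η / 2 / (|g y| + 1) * (|z.1| * |g z.2|) ≤
        η / 2 / (|g y| + 1) * (|z.1| * (|g y| + 1)) := by gcongr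
    refine this.trans (le_of_eq ?_)
    field_simp
  have e2 : |z.1 * (g z.2 * b - invPerturbationDeriv φ h₀ g z.2)| ≤ |z.1| * (η / 2) := by
    rw [abs_mul]
    gcongr
  have e3 := abs_add_le ((orliczPerturbation φ h₀ g z.1 z.2)⁻¹ - (h₀ z.2)⁻¹ - z.1 * g z.2 * b)
    (z.1 * (g z.2 * b - invPerturbationDeriv φ h₀ g z.2))
  have e4 : (orliczPerturbation φ h₀ g z.1 z.2)⁻¹ - (h₀ z.2)⁻¹ - z.1 * g z.2 * b +
      z.1 * (g z.2 * b - invPerturbationDeriv φ h₀ g z.2) =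
      (orliczPerturbation φ h₀ g z.1 z.2)⁻¹ - (h₀ z.2)⁻¹ -
        z.1 * invPerturbationDeriv φ h₀ g z.2 := by ring
  rw [e4] at e3
  have e5 : |(orliczPerturbation φ h₀ g z.1 z.2)⁻¹ - (h₀ z.2)⁻¹ - z.1 * g z.2 * b| ≤
      η / 2 / (|g y| + 1) * (|z.1| * |g z.2|) := h1
  linarith

end IsPerturbationData

/-! ### Images of signed measures, regularity on the sphere, and the curvature measure -/

/-- The change of variables formula for the image of a signed measure with density. -/
lemma integral_map_withDensityᵥ {X Y : Type*} [MeasurableSpace X] [MeasurableSpace Y]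
    {ν : Measure X} {F : X → ℝ} (hF : Integrable F ν) {A : X → Y} (hA : Measurable A)
    {f : Y → ℝ} (hf : Measurable f) {C : ℝ} (hC : ∀ y, |f y| ≤ C) :
    ((ν.withDensityᵥ F).map A).Integrable f ∧
      ∫ᵛ y, f y ∂•((ν.withDensityᵥ F).map A) = ∫ x, F x * f (A x) ∂ν := by
  have hkm : Measurable (f ∘ A) := hf.comp hA
  have hbdd : ∀ m : Measure X, IsFiniteMeasure m → Integrable (f ∘ A) m := fun m _ =>
    Integrable.of_bound hkm.aestronglyMeasurable C (Eventually.of_forall fun x => hC (A x))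
  have hint : (ν.withDensityᵥ F).Integrable (f ∘ A) := by
    rw [VectorMeasure.Integrable, Measure.variation_withDensityᵥ hF]
    exact hbdd _ ⟨by rw [withDensity_apply _ MeasurableSet.univ, Measure.restrict_univ]; exact hF.2⟩
  refine ⟨VectorMeasure.Integrable.map hf.aestronglyMeasurable hint, ?_⟩
  rw [VectorMeasure.integral_map hA hf.aestronglyMeasurable hint]
  have hp : IsFiniteMeasure (ν.withDensity fun x => ENNReal.ofReal (F x)) :=
    isFiniteMeasure_withDensity_ofReal hF.2
  have hq : IsFiniteMeasure (ν.withDensity fun x => ENNReal.ofReal (-F x)) :=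
    isFiniteMeasure_withDensity_ofReal hF.neg.2
  have hflip : ContinuousLinearMap.lsmul ℝ ℝ = (ContinuousLinearMap.lsmul ℝ ℝ (E := ℝ)).flip := by
    ext
    simp
  have hFm := hF.aestronglyMeasurable.aemeasurable
  have hFn : AEMeasurable (fun x => -F x) ν := hFm.neg
  have hpi := hbdd _ hp
  have hqi := hbdd _ hq
  have hp' := (integrable_withDensity_iff_integrable_smul₀' hFm.ennreal_ofReal
    (Eventually.of_forall fun _ => ENNReal.ofReal_lt_top)).1 hpi
  have hq' := (integrable_withDensity_iff_integrable_smul₀' hFn.ennreal_ofReal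
    (Eventually.of_forall fun _ => ENNReal.ofReal_lt_top)).1 hqi
  -- The signed measure is split into the finite measures with densities `F⁺` and `F⁻`; the two
  -- integrals recombine through `F⁺ - F⁻ = F`.
  rw [withDensityᵥ_eq_withDensity_pos_part_sub_withDensity_neg_part hF, hflip,
    VectorMeasure.integral_sub_vectorMeasure
      (by rwa [VectorMeasure.Integrable, Measure.variation_toSignedMeasure])
      (by rwa [VectorMeasure.Integrable, Measure.variation_toSignedMeasure]),
    VectorMeasure.integral_toSignedMeasure, VectorMeasure.integral_toSignedMeasure,
    integral_withDensity_eq_integral_toReal_smul₀ hFm.ennreal_ofReal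
      (Eventually.of_forall fun _ => ENNReal.ofReal_lt_top),
    integral_withDensity_eq_integral_toReal_smul₀ hFn.ennreal_ofReal
      (Eventually.of_forall fun _ => ENNReal.ofReal_lt_top)]
  refine (integral_sub hp' hq').symm.trans ?_
  refine integral_congr_ae (Eventually.of_forall fun x => ?_)
  simp only [Function.comp_apply, smul_eq_mul, ENNReal.toReal_ofReal', ← sub_mul]
  rcases le_total 0 (F x) with h | h <;> simp [h]

instance : IsFiniteMeasure (sphereMeasure n) := by
  unfold sphereMeasure
  infer_instance

lemma wulffGauge_congr {Ω : Set (Sphere n)} {f₁ f₂ : Sphere n → ℝ} (h : EqOn f₁ f₂ Ω) :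
    wulffGauge Ω f₁ = wulffGauge Ω f₂ := by
  funext x
  rw [wulffGauge, wulffGauge, image_congr fun v hv => by rw [h hv]]

lemma aleksandrovBody_congr {Ω : Set (Sphere n)} {f₁ f₂ : Sphere n → ℝ} (h : EqOn f₁ f₂ Ω) :
    aleksandrovBody Ω f₁ = aleksandrovBody Ω f₂ :=
  iInter₂_congr fun v hv => by rw [h hv]

/-- Test the maximiser for `f₁` in the maximum for `f₂`, with `|⟨u, v⟩| ≤ 1`. -/
lemma IsWulffData.wulffGauge_le_add {Ω : Set (Sphere n)} {f₁ f₂ : Sphere n → ℝ} {κ : ℝ}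
    (H₁ : IsWulffData Ω f₁) (H₂ : IsWulffData Ω f₂)
    (h : ∀ v ∈ Ω, |(f₁ v)⁻¹ - (f₂ v)⁻¹| ≤ κ) (u : Sphere n) :
    wulffGauge Ω f₁ u ≤ wulffGauge Ω f₂ u + κ := by
  obtain ⟨v, hv, hu⟩ := H₁.exists_eq_wulffGauge u
  have h2 := H₂.inner_div_le u hv
  have h3 : |inner ℝ (u : EuclideanSpace ℝ (Fin n)) (v : EuclideanSpace ℝ (Fin n))| ≤ 1 := by
    simpa using abs_real_inner_le_norm (u : EuclideanSpace ℝ (Fin n)) (v : EuclideanSpace ℝ (Fin n))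
  have h4 : inner ℝ (u : EuclideanSpace ℝ (Fin n)) (v : EuclideanSpace ℝ (Fin n)) *
      ((f₁ v)⁻¹ - (f₂ v)⁻¹) ≤ 1 * κ := by
    refine (le_abs_self _).trans ?_
    rw [abs_mul]
    exact mul_le_mul h3 (h v hv) (abs_nonneg _) zero_le_one
  rw [div_eq_mul_inv] at hu h2
  linarith

lemma IsWulffData.continuous_radialFn {Ω : Set (Sphere n)} {f : Sphere n → ℝ}
    (H : IsWulffData Ω f) : Continuous (radialFn (aleksandrovBody Ω f)) := by
  rw [funext H.radialFn_eq]
  exact (H.continuous_wulffGauge.comp continuous_subtype_val).inv₀ fun u =>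
    (H.wulffGauge_pos (Sphere.coe_ne_zero u)).ne'

lemma IsWulffData.continuous_comp_radialFn {Ω : Set (Sphere n)} {f : Sphere n → ℝ}
    (H : IsWulffData Ω f) {G : ℝ → Sphere n → ℝ}
    (hG : ContinuousOn (fun p : ℝ × Sphere n => G p.1 p.2) (Ioi 0 ×ˢ univ)) :
    Continuous fun u => G (radialFn (aleksandrovBody Ω f) u) u :=
  hG.comp_continuous (H.continuous_radialFn.prodMk continuous_id) fun u =>
    ⟨H.radialFn_pos u, mem_univ _⟩

lemma integrable_of_continuous {F : Sphere n → ℝ} (hF : Continuous F) :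
    Integrable F (sphereMeasure n) :=
  hF.integrable_of_hasCompactSupport (HasCompactSupport.of_compactSpace F)

/-- A function continuous only on `Ω` is extended by zero, which makes it a Borel function on the
sphere that can be composed with the radial Gauss map. -/
lemma measurable_indicator_of_continuousOn {Ω : Set (Sphere n)} (hΩ : IsCompact Ω)
    {f : Sphere n → ℝ} (hf : ContinuousOn f Ω) : Measurable (Ω.indicator f) := by
  classical
  rw [← piecewise_eq_indicator]
  exact hf.measurable_piecewise continuousOn_const hΩ.measurableSet

lemma exists_abs_indicator_le {Ω : Set (Sphere n)} (hΩ : IsCompact Ω)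
    {f : Sphere n → ℝ} (hf : ContinuousOn f Ω) : ∃ C, ∀ u, |Ω.indicator f u| ≤ C := by
  obtain ⟨C, hC⟩ := hΩ.exists_bound_of_continuousOn hf
  refine ⟨max C 0, fun u => ?_⟩
  by_cases hu : u ∈ Ω
  · rw [indicator_of_mem hu]
    exact (hC u hu).trans (le_max_left _ _)
  · rw [indicator_of_notMem hu, abs_zero]
    exact le_max_right _ _

/-- Mean value inequality, with `G_t` bounded on the compact set `[r₁, r₂] × S^{n-1}`. -/
lemma exists_abs_sub_le {G : ℝ → Sphere n → ℝ}
    (hG_diff : ∀ t : ℝ, 0 < t → ∀ u, DifferentiableAt ℝ (fun s => G s u) t)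
    (hG_t : ContinuousOn (fun p : ℝ × Sphere n => partialT G p.1 p.2) (Ioi 0 ×ˢ univ))
    {r₁ r₂ : ℝ} (hr₁ : 0 < r₁) :
    ∃ C, ∀ s ∈ Icc r₁ r₂, ∀ t ∈ Icc r₁ r₂, ∀ u, |G t u - G s u| ≤ C * |t - s| := by
  obtain ⟨C, hC⟩ := (isCompact_Icc.prod isCompact_univ).exists_bound_of_continuousOn
    (hG_t.mono (prod_mono (fun t (ht : t ∈ Icc r₁ r₂) => hr₁.trans_le ht.1) subset_rfl))
  refine ⟨C, fun s hs t ht u => ?_⟩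
  exact (convex_Icc r₁ r₂).norm_image_sub_le_of_norm_deriv_le (f := fun s => G s u)
    (fun x hx => hG_diff x (hr₁.trans_le hx.1) u) (fun x hx => hC (x, u) ⟨hx, mem_univ _⟩) hs ht

lemma IsDualOrliczCurvatureMeasure.eq {G : ℝ → Sphere n → ℝ} {ψ : ℝ → ℝ}
    {K : Set (EuclideanSpace ℝ (Fin n))} {μ₁ μ₂ : SignedMeasure (Sphere n)}
    (h₁ : IsDualOrliczCurvatureMeasure G ψ K μ₁) (h₂ : IsDualOrliczCurvatureMeasure G ψ K μ₂) :
    μ₁ = μ₂ :=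
  VectorMeasure.ext fun E hE => by rw [h₁.apply_eq E hE, h₂.apply_eq E hE]

lemma IsDualOrliczCurvatureMeasure.dualOrliczCurvatureMeasure_eq {G : ℝ → Sphere n → ℝ} {ψ : ℝ → ℝ}
    {K : Set (EuclideanSpace ℝ (Fin n))} {μ : SignedMeasure (Sphere n)}
    (h : IsDualOrliczCurvatureMeasure G ψ K μ) : dualOrliczCurvatureMeasure G ψ K = μ := by
  have hex : ∃ μ, IsDualOrliczCurvatureMeasure G ψ K μ := ⟨μ, h⟩
  rw [dualOrliczCurvatureMeasure, dif_pos hex]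
  exact hex.choose_spec.eq h

/-- The curvature measure as the image, under the radial Gauss map, of the measure on the sphere
with the curvature integrand as its density. -/
lemma IsWulffData.isDualOrliczCurvatureMeasure_map {Ω : Set (Sphere n)} {f : Sphere n → ℝ}
    (H : IsWulffData Ω f) {G : ℝ → Sphere n → ℝ} {ψ : ℝ → ℝ}
    (hint : Integrable (curvatureIntegrand G ψ (aleksandrovBody Ω f)) (sphereMeasure n)) :
    IsDualOrliczCurvatureMeasure G ψ (aleksandrovBody Ω f)
      (((sphereMeasure n).withDensityᵥ fun u =>
        (1 / (n : ℝ)) * curvatureIntegrand G ψ (aleksandrovBody Ω f) u).map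
          (H.aemeasurable_radialGaussMap.mk _)) := by
  have hA := H.aemeasurable_radialGaussMap.measurable_mk
  -- The reverse radial Gauss image is the preimage under the radial Gauss map at every direction of
  -- differentiability, hence up to a null set. Measurability and the defining integral both follow.
  have hae : ∀ S : Set (Sphere n), (H.aemeasurable_radialGaussMap.mk _ ⁻¹' S : Set (Sphere n))
      =ᵐ[sphereMeasure n] reverseRadialGaussImage (aleksandrovBody Ω f) S := by
    intro S
    rw [eventuallyEq_set]
    filter_upwards [H.ae_differentiableAt, H.aemeasurable_radialGaussMap.ae_eq_mk] with u hd hu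
    rw [H.mem_reverseRadialGaussImage_iff hd, mem_preimage, ← hu]
  refine ⟨hint, fun S hS => ?_, fun S hS => ?_⟩
  · exact (hA hS).nullMeasurableSet.congr (hae S)
  · rw [VectorMeasure.map_apply _ hA hS, withDensityᵥ_apply (hint.const_mul _) (hA hS),
      integral_const_mul, setIntegral_congr_set (hae S)]

/-! ### The variational formula -/

namespace IsPerturbationData

variable {Ω : Set (Sphere n)} {φ : ℝ → ℝ} {h₀ g : Sphere n → ℝ}
  (H : IsPerturbationData Ω φ h₀ g)
include H

lemma aleksandrovBody_zero :
    aleksandrovBody Ω (orliczPerturbation φ h₀ g 0) = aleksandrovBody Ω h₀ :=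
  aleksandrovBody_congr fun _ hu => H.orliczPerturbation_zero hu

lemma wulffGauge_zero : wulffGauge Ω (orliczPerturbation φ h₀ g 0) = wulffGauge Ω h₀ :=
  wulffGauge_congr fun _ hu => H.orliczPerturbation_zero hu

lemma eventually_isWulffData :
    ∀ᶠ ε in 𝓝 (0 : ℝ), IsWulffData Ω (orliczPerturbation φ h₀ g ε) :=
  H.eventually_mem_image.mono fun _ => H.isWulffData_orliczPerturbation

lemma exists_abs_wulffGauge_sub_le : ∃ C, 0 ≤ C ∧ ∀ᶠ ε in 𝓝 (0 : ℝ), ∀ u : Sphere n,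
    |wulffGauge Ω (orliczPerturbation φ h₀ g ε) u - wulffGauge Ω h₀ u| ≤ C * |ε| := by
  obtain ⟨B, hB⟩ := H.wulff.isCompact.exists_bound_of_continuousOn
    H.continuousOn_invPerturbationDeriv
  obtain ⟨v₀, hv₀⟩ := H.wulff.nonempty
  have hB0 : 0 ≤ B := (norm_nonneg _).trans (hB v₀ hv₀)
  refine ⟨1 + B, by linarith, ?_⟩
  filter_upwards [H.eventually_isWulffData, H.eventually_inv_expansion one_pos] with ε h1 h2 u
  have h3 : ∀ v ∈ Ω, |(orliczPerturbation φ h₀ g ε v)⁻¹ - (h₀ v)⁻¹| ≤ (1 + B) * |ε| := by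
    intro v hv
    have h4 := abs_add_le ((orliczPerturbation φ h₀ g ε v)⁻¹ - (h₀ v)⁻¹ -
      ε * invPerturbationDeriv φ h₀ g v) (ε * invPerturbationDeriv φ h₀ g v)
    rw [sub_add_cancel, abs_mul] at h4
    have h5 : |ε| * |invPerturbationDeriv φ h₀ g v| ≤ |ε| * B :=
      mul_le_mul_of_nonneg_left (hB v hv) (abs_nonneg _)
    linarith [h2 v hv]
  have h6 := h1.wulffGauge_le_add H.wulff h3 u
  have h7 := H.wulff.wulffGauge_le_add h1 (fun v hv => by rw [abs_sub_comm]; exact h3 v hv) u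
  rw [abs_le]
  constructor <;> linarith

lemma exists_radialFn_bounds : ∃ r₁ r₂ C : ℝ, 0 < r₁ ∧ ∀ᶠ ε in 𝓝 (0 : ℝ), ∀ u : Sphere n,
    radialFn (aleksandrovBody Ω (orliczPerturbation φ h₀ g ε)) u ∈ Icc r₁ r₂ ∧
    |radialFn (aleksandrovBody Ω (orliczPerturbation φ h₀ g ε)) u -
      radialFn (aleksandrovBody Ω h₀) u| ≤ C * |ε| := by
  obtain ⟨C, hC0, hC⟩ := H.exists_abs_wulffGauge_sub_le
  obtain ⟨c, hc, hcM⟩ := H.wulff.exists_le_wulffGauge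
  obtain ⟨D, hD⟩ := isCompact_univ.exists_bound_of_continuousOn
    (H.wulff.continuous_wulffGauge.comp (continuous_subtype_val (p := fun x => x ∈
      Metric.sphere (0 : EuclideanSpace ℝ (Fin n)) 1))).continuousOn
  have hsmall : ∀ᶠ ε in 𝓝 (0 : ℝ), C * |ε| < c / 2 := by
    have : Tendsto (fun ε : ℝ => C * |ε|) (𝓝 0) (𝓝 (C * |0|)) :=
      (continuous_const.mul continuous_abs).tendsto 0
    rw [abs_zero, mul_zero] at this
    exact this.eventually (gt_mem_nhds (half_pos hc))
  obtain ⟨v₀, -⟩ := H.wulff.nonempty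
  have hD0 : 0 ≤ D := (norm_nonneg _).trans (hD v₀ (mem_univ _))
  -- The gauge of `[h₀]` lies in `[c, D]` on the sphere and the perturbed one within `c / 2` of it.
  -- The Lipschitz constant comes from `1/x - 1/y = (y - x)/(xy)` with `xy ≥ (c / 2) c`.
  refine ⟨(D + c / 2)⁻¹, (c / 2)⁻¹, C / (c / 2 * c), inv_pos.2 (by linarith), ?_⟩
  filter_upwards [H.eventually_isWulffData, hC, hsmall] with ε h1 h2 h3 u
  rw [h1.radialFn_eq, H.wulff.radialFn_eq]
  have h4 := h2 u
  have h5 := abs_le.1 h4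
  have h6 := hcM u
  have h7 : wulffGauge Ω h₀ u ≤ D := (le_abs_self _).trans (hD u (mem_univ _))
  set x := wulffGauge Ω (orliczPerturbation φ h₀ g ε) u
  set y := wulffGauge Ω h₀ u
  have hx : c / 2 ≤ x := by linarith
  have hx0 : 0 < x := (half_pos hc).trans_le hx
  have hy0 : 0 < y := hc.trans_le h6
  refine ⟨⟨inv_anti₀ hx0 (by linarith), inv_anti₀ (half_pos hc) hx⟩, ?_⟩
  rw [inv_sub_inv hx0.ne' hy0.ne', abs_div, abs_of_pos (mul_pos hx0 hy0), abs_sub_comm,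
    div_mul_eq_mul_div]
  exact div_le_div₀ (by positivity) h4 (by positivity)
    (mul_le_mul hx h6 hc.le hx0.le)

lemma hasDerivAt_wulffGauge {u : Sphere n}
    (hd : DifferentiableAt ℝ (wulffGauge Ω h₀) (u : EuclideanSpace ℝ (Fin n))) :
    HasDerivAt (fun ε => wulffGauge Ω (orliczPerturbation φ h₀ g ε) u)
      (inner ℝ (u : EuclideanSpace ℝ (Fin n))
        (radialGaussMap (aleksandrovBody Ω h₀) u : EuclideanSpace ℝ (Fin n)) *
        invPerturbationDeriv φ h₀ g (radialGaussMap (aleksandrovBody Ω h₀) u)) 0 := by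
  have hF0 : EqOn (fun v : Sphere n => inner ℝ (u : EuclideanSpace ℝ (Fin n))
      (v : EuclideanSpace ℝ (Fin n)) / orliczPerturbation φ h₀ g 0 v)
      (fun v : Sphere n => inner ℝ (u : EuclideanSpace ℝ (Fin n))
      (v : EuclideanSpace ℝ (Fin n)) / h₀ v) Ω := fun v hv => by
    simp only [H.orliczPerturbation_zero hv]
  refine hasDerivAt_of_isGreatest_image H.wulff.isCompact
    (F := fun ε (v : Sphere n) => inner ℝ (u : EuclideanSpace ℝ (Fin n))
      (v : EuclideanSpace ℝ (Fin n)) / orliczPerturbation φ h₀ g ε v)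
    (p := fun v : Sphere n => inner ℝ (u : EuclideanSpace ℝ (Fin n))
      (v : EuclideanSpace ℝ (Fin n)) * invPerturbationDeriv φ h₀ g v)
    (H.wulff.radialGaussMap_spec hd).1 ((H.wulff.continuousOn_inner_div u).congr hF0)
    (ContinuousOn.mul (by fun_prop) H.continuousOn_invPerturbationDeriv)
    (H.eventually_isWulffData.mono fun ε h => h.isGreatest_wulffGauge u) ?_ ?_
  · intro w hw h
    rw [H.wulffGauge_zero] at h
    exact H.wulff.eq_radialGaussMap hd
      (H.wulff.mem_radialGaussImage_of_eq_wulffGauge hw ((hF0 hw).symm.trans h))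
  · intro η hη
    filter_upwards [H.eventually_inv_expansion hη] with ε hε w hw
    have h1 : |inner ℝ (u : EuclideanSpace ℝ (Fin n)) (w : EuclideanSpace ℝ (Fin n))| ≤ 1 := by
      simpa using
        abs_real_inner_le_norm (u : EuclideanSpace ℝ (Fin n)) (w : EuclideanSpace ℝ (Fin n))
    have h2 := mul_le_mul h1 (hε w hw) (abs_nonneg _) zero_le_one
    rw [← abs_mul, one_mul] at h2
    refine le_trans (le_of_eq ?_) h2
    simp only [H.orliczPerturbation_zero hw]
    congr 1
    ring

lemma hasDerivAt_radialFn {u : Sphere n}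
    (hd : DifferentiableAt ℝ (wulffGauge Ω h₀) (u : EuclideanSpace ℝ (Fin n))) :
    HasDerivAt (fun ε => radialFn (aleksandrovBody Ω (orliczPerturbation φ h₀ g ε)) u)
      (radialFn (aleksandrovBody Ω h₀) u /
        (supportFn (aleksandrovBody Ω h₀) (radialGaussMap (aleksandrovBody Ω h₀) u) *
          deriv φ (supportFn (aleksandrovBody Ω h₀) (radialGaussMap (aleksandrovBody Ω h₀) u))) *
        g (radialGaussMap (aleksandrovBody Ω h₀) u)) 0 := by
  have hM := H.wulff.wulffGauge_pos u.coe_ne_zero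
  obtain ⟨hmem, hmax⟩ := H.wulff.radialGaussMap_spec hd
  have hpos := H.wulff.pos _ hmem
  have hne := H.deriv_ne_zero _ hpos
  have h1 := (H.hasDerivAt_wulffGauge hd).fun_inv (by rw [H.wulffGauge_zero]; exact hM.ne')
  rw [H.wulff.supportFn_eq_of_eq_wulffGauge hmem hmax, H.wulff.radialFn_eq]
  refine (h1.congr_of_eventuallyEq
    (H.eventually_isWulffData.mono fun ε h => h.radialFn_eq u)).congr_deriv ?_
  -- At the maximiser the inner product equals `M(u) h₀(α_K(u))`; the factor `h₀` cancels one power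
  -- of `h₀²`, leaving `ψ(h₀) = h₀ φ'(h₀)` in the denominator.
  rw [H.wulffGauge_zero, invPerturbationDeriv, (div_eq_iff hpos.ne').1 hmax]
  field_simp

variable {G : ℝ → Sphere n → ℝ}

lemma hasDerivAt_comp_radialFn
    (hG_diff : ∀ t : ℝ, 0 < t → ∀ u, DifferentiableAt ℝ (fun s => G s u) t) {u : Sphere n}
    (hd : DifferentiableAt ℝ (wulffGauge Ω h₀) (u : EuclideanSpace ℝ (Fin n))) :
    HasDerivAt (fun ε => G (radialFn (aleksandrovBody Ω (orliczPerturbation φ h₀ g ε)) u) u)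
      (curvatureIntegrand G (fun t => t * deriv φ t) (aleksandrovBody Ω h₀) u *
        g (radialGaussMap (aleksandrovBody Ω h₀) u)) 0 := by
  have h1 : HasDerivAt (fun s => G s u) (partialT G (radialFn (aleksandrovBody Ω h₀) u) u)
      (radialFn (aleksandrovBody Ω (orliczPerturbation φ h₀ g 0)) u) := by
    rw [H.aleksandrovBody_zero]
    exact (hG_diff _ (H.wulff.radialFn_pos u) u).hasDerivAt
  refine (h1.comp (0 : ℝ) (H.hasDerivAt_radialFn hd)).congr_deriv ?_
  rw [curvatureIntegrand]
  ring

/-- Almost everywhere `α_K(u) ∈ Ω` and `h_K = h₀` there, so the integrand is a continuous function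
of `u` times a bounded Borel function of `α_K(u)`. -/
lemma integrable_curvatureIntegrand
    (hG_t : ContinuousOn (fun p : ℝ × Sphere n => partialT G p.1 p.2) (Ioi 0 ×ˢ univ)) :
    Integrable (curvatureIntegrand G (fun t => t * deriv φ t) (aleksandrovBody Ω h₀))
      (sphereMeasure n) := by
  have hψ : ContinuousOn (fun v => (h₀ v * deriv φ (h₀ v))⁻¹) Ω :=
    (H.wulff.continuousOn.mul H.continuousOn_deriv_comp).inv₀ fun v hv =>
      mul_ne_zero (H.wulff.pos v hv).ne' (H.deriv_ne_zero _ (H.wulff.pos v hv))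
  obtain ⟨C, hC⟩ := exists_abs_indicator_le H.wulff.isCompact hψ
  have hmeas := (measurable_indicator_of_continuousOn H.wulff.isCompact hψ).comp_aemeasurable
    H.wulff.aemeasurable_radialGaussMap
  have hc : Continuous fun u => radialFn (aleksandrovBody Ω h₀) u *
      partialT G (radialFn (aleksandrovBody Ω h₀) u) u :=
    H.wulff.continuous_radialFn.mul (H.wulff.continuous_comp_radialFn hG_t)
  refine ((integrable_of_continuous hc).mul_bdd (c := C) hmeas.aestronglyMeasurable
    (Eventually.of_forall fun u => hC _)).congr ?_
  filter_upwards [H.wulff.ae_differentiableAt] with u hd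
  obtain ⟨hmem, hmax⟩ := H.wulff.radialGaussMap_spec hd
  rw [curvatureIntegrand, Function.comp_apply, indicator_of_mem hmem,
    H.wulff.supportFn_eq_of_eq_wulffGauge hmem hmax, div_eq_mul_inv]

lemma tendsto_generalDualVolume
    (hG : ContinuousOn (fun p : ℝ × Sphere n => G p.1 p.2) (Ioi 0 ×ˢ univ))
    (hG_diff : ∀ t : ℝ, 0 < t → ∀ u, DifferentiableAt ℝ (fun s => G s u) t)
    (hG_t : ContinuousOn (fun p : ℝ × Sphere n => partialT G p.1 p.2) (Ioi 0 ×ˢ univ)) :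
    Tendsto (fun ε : ℝ =>
      (generalDualVolume G (aleksandrovBody Ω (orliczPerturbation φ h₀ g ε)) -
        generalDualVolume G (aleksandrovBody Ω h₀)) / ε) (𝓝[≠] 0)
      (𝓝 (∫ u, curvatureIntegrand G (fun t => t * deriv φ t) (aleksandrovBody Ω h₀) u *
        g (radialGaussMap (aleksandrovBody Ω h₀) u) ∂sphereMeasure n)) := by
  obtain ⟨r₁, r₂, C, hr₁, hr⟩ := H.exists_radialFn_bounds
  obtain ⟨L, hL⟩ := exists_abs_sub_le hG_diff hG_t (r₂ := r₂) hr₁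
  have hr0 := hr.self_of_nhds
  rw [H.aleksandrovBody_zero] at hr0
  have hint0 := integrable_of_continuous (H.wulff.continuous_comp_radialFn hG)
  have hw : ∀ᶠ ε in 𝓝[≠] (0 : ℝ), IsWulffData Ω (orliczPerturbation φ h₀ g ε) :=
    H.eventually_isWulffData.filter_mono nhdsWithin_le_nhds
  -- The dominating constant is the Lipschitz bound of `G` in `t` times that of the radial function
  -- in `ε`; the absolute value is taken because `L` comes without a sign.
  refine (tendsto_integral_filter_of_dominated_convergence (fun _ => |L| * C)
    (F := fun ε u => ε⁻¹ * (G (radialFn (aleksandrovBody Ω (orliczPerturbation φ h₀ g ε)) u) u -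
      G (radialFn (aleksandrovBody Ω h₀) u) u)) ?_ ?_ (integrable_const _) ?_).congr' ?_
  · filter_upwards [hw] with ε hε
    exact (((hε.continuous_comp_radialFn hG).sub
      (H.wulff.continuous_comp_radialFn hG)).const_smul ε⁻¹).aestronglyMeasurable
  · filter_upwards [hr.filter_mono nhdsWithin_le_nhds, self_mem_nhdsWithin] with ε hε hε0
    refine Eventually.of_forall fun u => ?_
    have h1 := hL _ (hr0 u).1 _ (hε u).1 u
    have h2 : 0 < |ε| := abs_pos.2 hε0
    rw [norm_mul, norm_inv, Real.norm_eq_abs, Real.norm_eq_abs, inv_mul_le_iff₀ h2]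
    calc _ ≤ L * _ := h1
      _ ≤ |L| * _ := mul_le_mul_of_nonneg_right (le_abs_self L) (abs_nonneg _)
      _ ≤ |L| * (C * |ε|) := mul_le_mul_of_nonneg_left (hε u).2 (abs_nonneg _)
      _ = _ := by ring
  · filter_upwards [H.wulff.ae_differentiableAt] with u hd
    have h1 := (hasDerivAt_iff_tendsto_slope.1 (H.hasDerivAt_comp_radialFn hG_diff hd))
    refine h1.congr fun ε => ?_
    rw [slope_def_field, H.aleksandrovBody_zero, sub_zero, div_eq_inv_mul]
  · filter_upwards [hw] with ε hε
    rw [integral_const_mul, integral_sub (integrable_of_continuous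
      (hε.continuous_comp_radialFn hG)) hint0, div_eq_inv_mul]
    rfl

lemma integral_dualOrliczCurvatureMeasure (hn : 1 ≤ n)
    (hG_t : ContinuousOn (fun p : ℝ × Sphere n => partialT G p.1 p.2) (Ioi 0 ×ˢ univ)) :
    (dualOrliczCurvatureMeasure G (fun t => t * deriv φ t) (aleksandrovBody Ω h₀)).IntegrableOn
        g Ω ∧
      (n : ℝ) * ∫ᵛ u in Ω, g u ∂•(dualOrliczCurvatureMeasure G (fun t => t * deriv φ t)
        (aleksandrovBody Ω h₀)) =
      ∫ u, curvatureIntegrand G (fun t => t * deriv φ t) (aleksandrovBody Ω h₀) u *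
        g (radialGaussMap (aleksandrovBody Ω h₀) u) ∂sphereMeasure n := by
  have hint := H.integrable_curvatureIntegrand hG_t
  rw [(H.wulff.isDualOrliczCurvatureMeasure_map hint).dualOrliczCurvatureMeasure_eq]
  obtain ⟨C, hC⟩ := exists_abs_indicator_le H.wulff.isCompact H.continuousOn_g
  obtain ⟨h1, h2⟩ := integral_map_withDensityᵥ (hint.const_mul (1 / (n : ℝ)))
    H.wulff.aemeasurable_radialGaussMap.measurable_mk
    (measurable_indicator_of_continuousOn H.wulff.isCompact H.continuousOn_g) hC
  have hΩ := H.wulff.isCompact.measurableSet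
  refine ⟨(VectorMeasure.integrable_indicator_iff hΩ).1 h1, ?_⟩
  rw [← VectorMeasure.integral_indicator hΩ, h2, ← integral_const_mul]
  refine integral_congr_ae ?_
  filter_upwards [H.wulff.ae_differentiableAt,
    H.wulff.aemeasurable_radialGaussMap.ae_eq_mk] with u hd hu
  -- The Gauss map lands in `Ω` almost everywhere, so restricting the integral to `Ω` loses nothing.
  rw [← hu, indicator_of_mem (H.wulff.radialGaussMap_spec hd).1]
  have hn0 : (n : ℝ) ≠ 0 := Nat.cast_ne_zero.2 (by lia)
  field_simp

end IsPerturbationData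

end DualOrlicz

end

theorem mainTheorem2 (n : ℕ) (hn : 1 ≤ n)
    (Ω : Set (DualOrlicz.Sphere n)) (hΩ : IsClosed Ω)
    (hΩ_hemi : ∀ v : DualOrlicz.Sphere n, ¬ Ω ⊆ DualOrlicz.closedHemisphere v)
    (g h₀ : DualOrlicz.Sphere n → ℝ) (hg : ContinuousOn g Ω)
    (hh₀ : ContinuousOn h₀ Ω) (hh₀_pos : ∀ u ∈ Ω, 0 < h₀ u)
    (a : EReal) (φ : ℝ → ℝ) (hφ : DualOrlicz.ClassJ a φ)
    (hφ_smooth : ContDiffOn ℝ 1 φ (Ioi 0)) (hφ_deriv : ∀ t : ℝ, 0 < t → deriv φ t ≠ 0)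
    (G : ℝ → DualOrlicz.Sphere n → ℝ)
    (hG : ContinuousOn (fun p : ℝ × DualOrlicz.Sphere n => G p.1 p.2) (Ioi 0 ×ˢ univ))
    (hG_diff : ∀ t : ℝ, 0 < t → ∀ u, DifferentiableAt ℝ (fun s => G s u) t)
    (hG_t : ContinuousOn (fun p : ℝ × DualOrlicz.Sphere n => DualOrlicz.partialT G p.1 p.2)
      (Ioi 0 ×ˢ univ)) :
    -- the objects in the formula are well defined
    (∀ᶠ ε in 𝓝 (0 : ℝ),
      (∀ u ∈ Ω, φ (h₀ u) + ε * g u ∈ φ '' Ioi 0) ∧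
      Integrable (fun u => G (DualOrlicz.radialFn (DualOrlicz.aleksandrovBody Ω
        (DualOrlicz.orliczPerturbation φ h₀ g ε)) u) u) (DualOrlicz.sphereMeasure n)) ∧
    DualOrlicz.IsDualOrliczCurvatureMeasure G (fun t => t * deriv φ t)
      (DualOrlicz.aleksandrovBody Ω h₀)
      (DualOrlicz.dualOrliczCurvatureMeasure G (fun t => t * deriv φ t)
        (DualOrlicz.aleksandrovBody Ω h₀)) ∧
    (DualOrlicz.dualOrliczCurvatureMeasure G (fun t => t * deriv φ t)
      (DualOrlicz.aleksandrovBody Ω h₀)).IntegrableOn g Ω ∧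
    -- the variational formula
    Tendsto
      (fun ε : ℝ =>
        (DualOrlicz.generalDualVolume G
            (DualOrlicz.aleksandrovBody Ω (DualOrlicz.orliczPerturbation φ h₀ g ε)) -
          DualOrlicz.generalDualVolume G (DualOrlicz.aleksandrovBody Ω h₀)) / ε)
      (𝓝[≠] 0)
      (𝓝 ((n : ℝ) * ∫ᵛ u in Ω, g u ∂•(DualOrlicz.dualOrliczCurvatureMeasure G
        (fun t => t * deriv φ t) (DualOrlicz.aleksandrovBody Ω h₀)))) := by
  -- As `n ≥ 1`, the sphere has a point, so there is a closed hemisphere, and it would contain an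
  -- empty `Ω`.
  have hne : Ω.Nonempty := by
    have hmem : EuclideanSpace.single (⟨0, hn⟩ : Fin n) (1 : ℝ) ∈
        Metric.sphere (0 : EuclideanSpace ℝ (Fin n)) 1 := by simp
    exact nonempty_iff_ne_empty.2 fun h => hΩ_hemi ⟨_, hmem⟩ (h ▸ empty_subset _)
  have H : DualOrlicz.IsPerturbationData Ω φ h₀ g :=
    { wulff := ⟨hΩ.isCompact, hne,
        DualOrlicz.exists_inner_pos_of_not_subset_closedHemisphere hΩ_hemi, hh₀, hh₀_pos⟩
      continuousOn_g := hg
      contDiffOn := hφ_smooth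
      injOn := hφ.strictMono_or_strictAnti.elim (fun h => h.injOn) fun h => h.injOn
      deriv_ne_zero := hφ_deriv }
  have hC := H.wulff.isDualOrliczCurvatureMeasure_map (H.integrable_curvatureIntegrand hG_t)
  obtain ⟨h1, h2⟩ := H.integral_dualOrliczCurvatureMeasure hn hG_t
  refine ⟨?_, hC.dualOrliczCurvatureMeasure_eq.symm ▸ hC, h1, ?_⟩
  · filter_upwards [H.eventually_mem_image] with ε hε
    exact ⟨hε, DualOrlicz.integrable_of_continuous
      ((H.isWulffData_orliczPerturbation hε).continuous_comp_radialFn hG)⟩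
  · rw [h2]
    exact H.tendsto_generalDualVolume hG hG_diff hG_t
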